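/- Let $k\ge 1$, $d\ge 2k+1$ and $\beta>0$. Let $\mu_1,\dots,\mu_k$ be Borel probability measures on $\mathbb{R}^d$ such that, for every $j$ and for $Z\sim\mu_j$, $\mathbb{E}\|Z\|^{2+\beta}<\infty$, $\mathbb{E}Z=0$, and the covariance matrix $(\mathbb{E}[Z_aZ_b])_{a,b=1}^d$ is invertible (that is, $\mu_j$ is $d$-dimensional). On a probability space $(\Omega,\mathcal{F},\mathbb{P})$ with a filtration $(\mathcal{F}_i)_{i\ge 0}$, let $\xi^j_1,\xi^j_2,\dots$ be, for each $j\in\{1,\dots,k\}$, i.i.d. with law $\mu_j$, and such that $\xi^j_{i+1}$ is independent of $\mathcal{F}_i$ for all $i\ge 0$ and all $j$. Let $\ell=(\ell(i))_{i\ge 0}$ be an adapted rule, i.e. $\ell(i)$ takes values in $\{1,\dots,k\}$ and is $\mathcal{F}_i$-measurable for every $i$, and let $X$ be the walk generated by $\mu_1,\dots,\mu_k$ and $\ell$: $$X_0=0,\qquad X_{i+1}=X_i+\xi^{\ell(i)}_{i+1}\quad (i\ge 0),$$ where $X_i$ is $\mathcal{F}_i$-measurable for every $i$ (the filtration contains the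 history of the walk). Then $X$ is transient: almost surely $\|X_n\|\to\infty$ as $n\to\infty$. -/

import Mathlib

open MeasureTheory ProbabilityTheory Filter

noncomputable section

namespace AdaptedWalk

/-- The measure `μ` on `ℝ^d` has `p` moments: `E ‖Z‖ ^ p < ∞` for `Z ∼ μ`. -/
def HasMoments {d : ℕ} (μ : Measure (EuclideanSpace ℝ (Fin d))) (p : ℝ) : Prop :=
  ∫⁻ x, ‖x‖ₑ ^ p ∂μ < ⊤

/-- The measure `μ` on `ℝ^d` has mean `0`. -/
def MeanZero {d : ℕ} (μ : Measure (EuclideanSpace ℝ (Fin d))) : Prop :=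
  Integrable (fun x => x) μ ∧ ∫ x, x ∂μ = 0

/-- The matrix `(E [Z_a Z_b])_{a,b}` for `Z ∼ μ`; it is the covariance matrix of a measure of
mean `0`. -/
def covMatrix {d : ℕ} (μ : Measure (EuclideanSpace ℝ (Fin d))) : Matrix (Fin d) (Fin d) ℝ :=
  Matrix.of fun a b => ∫ z, z a * z b ∂μ

/-- A measure (with finite second moments) on `ℝ^d` is `d`-dimensional if its covariance matrix
is invertible. -/
def IsFullDimensional {d : ℕ} (μ : Measure (EuclideanSpace ℝ (Fin d))) : Prop :=
  IsUnit (covMatrix μ)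

/-- `X` is the walk started at `0`, with `X_{i+1} = X_i + ξ^{ℓ(i)}_{i+1}`, generated by the
measures `μ_j` and by the rule `ℓ`, which is adapted to the filtration `F`. The steps `ξ^j_i` are
only used for `i ≥ 1`. The filtration contains the history of the walk, and the steps available
at time `i + 1` are independent of `F_i`, so that the rule cannot look into the future.
Nothing is assumed about the joint law of the `k` steps available at the same time. -/
structure IsGenerated {Ω : Type*} [mΩ : MeasurableSpace Ω] (P : Measure Ω) {d k : ℕ}
    (μ : Fin k → Measure (EuclideanSpace ℝ (Fin d)))
    (F : Filtration ℕ mΩ)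
    (ξ : Fin k → ℕ → Ω → EuclideanSpace ℝ (Fin d))
    (ℓ : ℕ → Ω → Fin k)
    (X : ℕ → Ω → EuclideanSpace ℝ (Fin d)) : Prop where
  step_measurable : ∀ j i, Measurable (ξ j (i + 1))
  step_law : ∀ j i, P.map (ξ j (i + 1)) = μ j
  step_indep : ∀ j, iIndepFun (fun i => ξ j (i + 1)) P
  step_indep_past : ∀ j i, Indep (MeasurableSpace.comap (ξ j (i + 1)) inferInstance) (F i) P
  rule_adapted : ∀ i, Measurable[F i] (ℓ i)
  walk_adapted : ∀ i, Measurable[F i] (X i)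
  walk_zero : ∀ ω, X 0 ω = 0
  walk_succ : ∀ i ω, X (i + 1) ω = X i ω + ξ (ℓ i ω) (i + 1) ω

/-- The process `X` is transient: almost surely `‖X_n‖ → ∞`. -/
def IsTransient {Ω : Type*} [MeasurableSpace Ω] (P : Measure Ω) {d : ℕ}
    (X : ℕ → Ω → EuclideanSpace ℝ (Fin d)) : Prop :=
  ∀ᵐ ω ∂P, Tendsto (fun n => ‖X n ω‖) atTop atTop

end AdaptedWalk

end

namespace AdaptedWalk

open scoped Topology RealInnerProductSpace

/-! ### Gaussian decay of characteristic functions near the origin, and small balls. -/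

section CharFun

/-! Fix a radius `r` and a time `n`, and split the event `‖X n‖ ≤ r` according to the vector `m`
counting how often each law has been used. For fixed `m`, the rule cannot do better than a
deterministic order (`IsGenerated.measure_useCount_eq_le`). Indeed, the probability that the walk
lands in the ball after the remaining `m - s` steps, taken independently, does not depend on their
order. Set to `0` once some count exceeds `m`, it is a supermartingale along any adapted rule.

A sum of `n` independent steps lies in the ball with probability `O(n ^ (-d / 2))`, uniformly in
`m`: near `0` its characteristic function is at most `exp (-c n ‖t‖ ^ 2)`, and Parseval turns this
into a small ball bound (`exists_measureReal_closedBall_le`). There are `O(n ^ (k - 1))` vectors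
`m`, so the total is `O(n ^ (k - 1 - d / 2))`, which is `O(n ^ (-3 / 2))` as `d ≥ 2 * k + 1`. This
is summable, and Borel–Cantelli concludes. -/

lemma norm_cexp_mul_I_sub_le (y : ℝ) :
    ‖Complex.exp (y * Complex.I) - (1 + y * Complex.I - (y : ℂ) ^ 2 / 2)‖
      ≤ 4 * (y ^ 2 * min |y| 1) := by
  have hn : ‖(y : ℂ) * Complex.I‖ = |y| := by simp
  rcases le_total |y| 1 with h | h
  · rw [min_eq_left h]
    have := Complex.exp_bound (x := y * Complex.I) (by rw [hn]; exact h) (n := 3) (by norm_num)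
    rw [hn] at this
    have e : ∑ m ∈ Finset.range 3, ((y : ℂ) * Complex.I) ^ m / (m.factorial : ℂ)
        = 1 + y * Complex.I - (y : ℂ) ^ 2 / 2 := by
      simp [Finset.sum_range_succ, mul_pow]
      ring
    rw [e] at this
    refine this.trans ?_
    have h3 : |y| ^ 3 = y ^ 2 * |y| := by rw [pow_succ, sq_abs]
    rw [h3]
    have : 0 ≤ y ^ 2 * |y| := by positivity
    norm_num [Nat.factorial]
    linarith
  · rw [min_eq_right h]
    have h1 : ‖Complex.exp (y * Complex.I)‖ = 1 := Complex.norm_exp_ofReal_mul_I y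
    have h2 : ‖(1 + y * Complex.I - (y : ℂ) ^ 2 / 2)‖ ≤ 1 + |y| + y ^ 2 / 2 := by
      refine (norm_sub_le _ _).trans ?_
      have := norm_add_le (1 : ℂ) (y * Complex.I)
      rw [hn] at this
      simp at this ⊢
      linarith
    have h3 := norm_sub_le (Complex.exp (y * Complex.I)) (1 + y * Complex.I - (y : ℂ) ^ 2 / 2)
    have h4 : |y| ≤ y ^ 2 := by rw [← sq_abs]; nlinarith
    have h5 : 1 ≤ y ^ 2 := h.trans h4
    linarith

variable {E : Type*} [NormedAddCommGroup E] [InnerProductSpace ℝ E] [FiniteDimensional ℝ E]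
  [MeasurableSpace E] [BorelSpace E]

/-- The characteristic function of a centered law is close to its second order Taylor
polynomial. -/
lemma norm_charFun_sub_le (μ : Measure E) [IsProbabilityMeasure μ] (h2 : MemLp (fun x => x) 2 μ)
    (h0 : ∫ x, x ∂μ = 0) (t : E) :
    ‖charFun μ t - ((1 - (∫ x, ⟪x, t⟫ ^ 2 ∂μ) / 2 : ℝ) : ℂ)‖
      ≤ 4 * ‖t‖ ^ 2 * ∫ x, ‖x‖ ^ 2 * min (‖x‖ * ‖t‖) 1 ∂μ := by
  have hint1 : Integrable (fun x : E => x) μ := h2.integrable (by norm_num)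
  have hsq : Integrable (fun x : E => ‖x‖ ^ 2) μ := h2.integrable_norm_pow (by norm_num)
  have hin : Integrable (fun x : E => ⟪x, t⟫) μ := hint1.inner_const t
  have hin2 : Integrable (fun x : E => ⟪x, t⟫ ^ 2) μ := by
    refine (hsq.mul_const (‖t‖ ^ 2)).mono' (by fun_prop) (ae_of_all _ fun x => ?_)
    rw [Real.norm_eq_abs, abs_pow, ← mul_pow]
    gcongr
    exact abs_real_inner_le_norm x t
  have hexp : Integrable (fun x : E => Complex.exp (⟪x, t⟫ * Complex.I)) μ := by
    refine Integrable.of_bound (C := 1) (by fun_prop) (ae_of_all _ fun x => ?_)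
    rw [Complex.norm_exp_ofReal_mul_I]
  have hinC : Integrable (fun x : E => (⟪x, t⟫ : ℂ) * Complex.I) μ := hin.ofReal.mul_const _
  have hin2C : Integrable (fun x : E => (⟪x, t⟫ : ℂ) ^ 2 / 2) μ := by
    have := (hin2.ofReal (𝕜 := ℂ)).div_const 2
    simpa using this
  have hmean : ∫ x, ⟪x, t⟫ ∂μ = 0 := by
    have := integral_inner (𝕜 := ℝ) hint1 t
    simp_rw [real_inner_comm t]
    rw [this, h0, inner_zero_right]
  have e : charFun μ t - ((1 - (∫ x, ⟪x, t⟫ ^ 2 ∂μ) / 2 : ℝ) : ℂ)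
      = ∫ x, (Complex.exp (⟪x, t⟫ * Complex.I)
        - (1 + ⟪x, t⟫ * Complex.I - (⟪x, t⟫ : ℂ) ^ 2 / 2)) ∂μ := by
    have hA : ∫ x, (⟪x, t⟫ : ℂ) * Complex.I ∂μ = 0 := by
      rw [integral_mul_const, integral_complex_ofReal, hmean]; simp
    have hB : ∫ x, (⟪x, t⟫ : ℂ) ^ 2 / 2 ∂μ = ((∫ x, ⟪x, t⟫ ^ 2 ∂μ : ℝ) : ℂ) / 2 := by
      rw [integral_div, ← integral_complex_ofReal]; simp
    have hC : Integrable (fun x : E => 1 + (⟪x, t⟫ : ℂ) * Complex.I) μ :=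
      (integrable_const _).add hinC
    have hD : Integrable (fun x : E => 1 + (⟪x, t⟫ : ℂ) * Complex.I - (⟪x, t⟫ : ℂ) ^ 2 / 2) μ :=
      hC.sub hin2C
    rw [integral_sub hexp hD, integral_sub hC hin2C,
      integral_add (integrable_const _) hinC, hA, hB, charFun_apply]
    simp
  rw [e, ← integral_const_mul]
  refine norm_integral_le_of_norm_le ?_ (ae_of_all _ fun x => ?_)
  · refine Integrable.const_mul (hsq.mono' (by fun_prop) (ae_of_all _ fun x => ?_)) _
    rw [Real.norm_of_nonneg (by positivity)]
    exact mul_le_of_le_one_right (by positivity) (min_le_right _ _)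
  · refine (norm_cexp_mul_I_sub_le _).trans ?_
    have h := abs_real_inner_le_norm x t
    have hs : ⟪x, t⟫ ^ 2 ≤ ‖x‖ ^ 2 * ‖t‖ ^ 2 := by
      rw [← mul_pow, ← sq_abs]; gcongr
    calc 4 * (⟪x, t⟫ ^ 2 * min |⟪x, t⟫| 1)
        ≤ 4 * ((‖x‖ ^ 2 * ‖t‖ ^ 2) * min (‖x‖ * ‖t‖) 1) := by gcongr
      _ = _ := by ring

/-- A centered law with nondegenerate second moments has a characteristic function which decays
like a Gaussian near `0`. -/
lemma exists_norm_charFun_le_exp (μ : Measure E) [IsProbabilityMeasure μ]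
    (h2 : MemLp (fun x => x) 2 μ) (h0 : ∫ x, x ∂μ = 0) {q : ℝ} (hq : 0 < q)
    (hQ : ∀ t, q * ‖t‖ ^ 2 ≤ ∫ x, ⟪x, t⟫ ^ 2 ∂μ) :
    ∃ c > 0, ∃ δ > 0, ∀ t, ‖t‖ ≤ δ → ‖charFun μ t‖ ≤ Real.exp (-c * ‖t‖ ^ 2) := by
  have hsq : Integrable (fun x : E => ‖x‖ ^ 2) μ := h2.integrable_norm_pow (by norm_num)
  set M := ∫ x, ‖x‖ ^ 2 ∂μ with hM
  have hlim : Tendsto (fun t : E => ∫ x, ‖x‖ ^ 2 * min (‖x‖ * ‖t‖) 1 ∂μ) (𝓝 0)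
      (𝓝 (∫ _, (0 : ℝ) ∂μ)) := by
    refine tendsto_integral_filter_of_dominated_convergence (fun x => ‖x‖ ^ 2)
      (Eventually.of_forall fun t => by fun_prop)
      (Eventually.of_forall fun t => ae_of_all _ fun x => ?_) hsq (ae_of_all _ fun x => ?_)
    · rw [Real.norm_of_nonneg (by positivity)]
      exact mul_le_of_le_one_right (by positivity) (min_le_right _ _)
    · have : Continuous fun t : E => ‖x‖ ^ 2 * min (‖x‖ * ‖t‖) 1 := by fun_prop
      simpa using this.tendsto 0
  rw [integral_zero] at hlim
  -- With `q / 16` the Taylor error is at most `q / 4 * ‖t‖ ^ 2`, half of the main term `Q / 2 ≥ q /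
  -- 2 * ‖t‖ ^ 2`; this leaves `1 - q / 4 * ‖t‖ ^ 2`.
  have hev1 := hlim.eventually_lt_const (show (0 : ℝ) < q / 16 by positivity)
  have hlim2 : Tendsto (fun t : E => M * ‖t‖ ^ 2) (𝓝 0) (𝓝 0) := by
    have : Continuous fun t : E => M * ‖t‖ ^ 2 := by fun_prop
    simpa using this.tendsto 0
  -- Ensures `Q ≤ 2`, so that `1 - Q / 2` is its own absolute value.
  have hev2 := hlim2.eventually_lt_const (show (0 : ℝ) < 2 by norm_num)
  obtain ⟨δ, hδ, hball⟩ := Metric.eventually_nhds_iff.1 (hev1.and hev2)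
  refine ⟨q / 4, by positivity, δ / 2, by positivity, fun t ht => ?_⟩
  obtain ⟨ha, hb⟩ := hball (y := t) (by rw [dist_zero_right]; linarith)
  have hQM : ∫ x, ⟪x, t⟫ ^ 2 ∂μ ≤ M * ‖t‖ ^ 2 := by
    rw [hM, ← integral_mul_const]
    refine integral_mono_of_nonneg (ae_of_all _ fun x => by positivity) (hsq.mul_const _)
      (ae_of_all _ fun x => ?_)
    dsimp only
    rw [← mul_pow, ← sq_abs]
    gcongr
    exact abs_real_inner_le_norm x t
  have hm := norm_charFun_sub_le μ h2 h0 t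
  set Q := ∫ x, ⟪x, t⟫ ^ 2 ∂μ
  have hQt := hQ t
  have h3 : ‖charFun μ t‖ ≤ ‖charFun μ t - ((1 - Q / 2 : ℝ) : ℂ)‖ + ‖((1 - Q / 2 : ℝ) : ℂ)‖ := by
    simpa using norm_add_le (charFun μ t - ((1 - Q / 2 : ℝ) : ℂ)) ((1 - Q / 2 : ℝ) : ℂ)
  rw [Complex.norm_of_nonneg (by linarith)] at h3
  have h4 : 4 * ‖t‖ ^ 2 * ∫ x, ‖x‖ ^ 2 * min (‖x‖ * ‖t‖) 1 ∂μ ≤ 4 * ‖t‖ ^ 2 * (q / 16) := by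
    gcongr
  have h5 := Real.add_one_le_exp (-(q / 4) * ‖t‖ ^ 2)
  linarith

/-- Parseval's identity for finite measures. -/
lemma integral_charFun_comm (μ ν : Measure E) [IsFiniteMeasure μ] [IsFiniteMeasure ν] :
    ∫ x, charFun μ x ∂ν = ∫ t, charFun ν t ∂μ := by
  simp_rw [charFun_apply]
  rw [integral_integral_swap]
  · simp_rw [real_inner_comm]
  · refine Integrable.of_bound (C := 1) (by unfold Function.uncurry; fun_prop)
      (ae_of_all _ fun x => ?_)
    rw [Function.uncurry, Complex.norm_exp_ofReal_mul_I]

/-- A small ball estimate under Gaussian decay of the characteristic function near `0`. -/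
lemma measureReal_closedBall_mul_le (ν : Measure E) [IsProbabilityMeasure ν] {r ρ b : ℝ}
    (hb : 0 < b) (hrρ : r * ρ ≤ 1)
    (hν : ∀ t, ‖t‖ ≤ 2 * ρ → ‖charFun ν t‖ ≤ Real.exp (-b * ‖t‖ ^ 2)) :
    ν.real (Metric.closedBall 0 r) * (volume.real (Metric.ball (0 : E) ρ) / 2) ^ 2
      ≤ volume.real (Metric.ball (0 : E) ρ) *
        (Real.pi / b) ^ (Module.finrank ℝ E / 2 : ℝ) := by
  set B := Metric.ball (0 : E) ρ
  set V : Measure E := volume.restrict B with hV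
  have hBfin : volume B < ⊤ := measure_ball_lt_top
  have : IsFiniteMeasure V := ⟨by simpa [hV] using hBfin⟩
  -- Symmetrizing makes the transform `‖charFun V x‖ ^ 2`, a nonnegative test function, while `W`
  -- still lives on the ball of radius `2 * ρ`.
  set W : Measure E := V ∗ V.map (fun x => -x) with hW
  have : IsFiniteMeasure (V.map (fun x => -x)) := inferInstance
  have hcf : ∀ x, charFun W x = ((‖charFun V x‖ ^ 2 : ℝ) : ℂ) := by
    intro x
    have hneg : charFun (V.map (fun x => -x)) x = (starRingEnd ℂ) (charFun V x) := by
      rw [← charFun_neg, charFun_apply, charFun_apply, integral_map (by fun_prop) (by fun_prop)]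
      simp
    rw [hW, charFun_conv, hneg, Complex.mul_conj, Complex.normSq_eq_norm_sq]
  -- Here `|⟪s, x⟫| ≤ ρ * r ≤ 1`, where the cosine is at least `1 / 2`.
  have hlow : ∀ x ∈ Metric.closedBall (0 : E) r, volume.real B / 2 ≤ ‖charFun V x‖ := by
    intro x hx
    rw [mem_closedBall_zero_iff] at hx
    have hexp : Integrable (fun s : E => Complex.exp (⟪s, x⟫ * Complex.I)) V := by
      refine Integrable.of_bound (C := 1) (by fun_prop) (ae_of_all _ fun x => ?_)
      rw [Complex.norm_exp_ofReal_mul_I]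
    have hre : (charFun V x).re = ∫ s, Real.cos ⟪s, x⟫ ∂V := by
      rw [charFun_apply, ← RCLike.re_eq_complex_re, ← integral_re hexp]
      simp [Complex.exp_ofReal_mul_I_re]
    refine le_trans ?_ (Complex.re_le_norm _)
    rw [hre]
    have : volume.real B / 2 = ∫ s, (1 / 2 : ℝ) ∂V := by
      simp [hV]; ring
    rw [this]
    refine integral_mono_ae (integrable_const _) ?_ ?_
    · refine Integrable.of_bound (C := 1) (by fun_prop) (ae_of_all _ fun x => ?_)
      exact Real.abs_cos_le_one _
    · refine (ae_restrict_iff' measurableSet_ball).2 (ae_of_all _ fun s hs => ?_)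
      rw [mem_ball_zero_iff] at hs
      have h1 : |⟪s, x⟫| ≤ 1 := by
        refine (abs_real_inner_le_norm s x).trans (le_trans ?_ hrρ)
        rw [mul_comm r]
        exact mul_le_mul hs.le hx (norm_nonneg _) ((norm_nonneg _).trans hs.le)
      have h2 := Real.one_sub_sq_div_two_le_cos (x := ⟪s, x⟫)
      have h3 : ⟪s, x⟫ ^ 2 ≤ 1 := by rw [← sq_abs]; exact pow_le_one₀ (abs_nonneg _) h1
      dsimp only
      linarith
  have hVb : ∀ x, ‖charFun V x‖ ≤ V.real Set.univ := fun x => norm_charFun_le x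
  have hmeas : Measurable fun x => ‖charFun V x‖ ^ 2 := by
    have := measurable_charFun (μ := V)
    fun_prop
  have hint : Integrable (fun x => ‖charFun V x‖ ^ 2) ν := by
    refine Integrable.of_bound (C := V.real Set.univ ^ 2) hmeas.aestronglyMeasurable
      (ae_of_all _ fun x => ?_)
    rw [Real.norm_of_nonneg (by positivity)]
    gcongr
    exact hVb x
  have hlower : ν.real (Metric.closedBall 0 r) * (volume.real B / 2) ^ 2
      ≤ ∫ x, ‖charFun V x‖ ^ 2 ∂ν := by
    have : ∫ x in Metric.closedBall 0 r, (volume.real B / 2) ^ 2 ∂ν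
        = ν.real (Metric.closedBall 0 r) * (volume.real B / 2) ^ 2 := by simp
    rw [← this]
    refine le_trans ?_ (setIntegral_le_integral (s := Metric.closedBall 0 r) hint
      (ae_of_all _ fun x => by positivity))
    refine setIntegral_mono_on (integrable_const _) hint.integrableOn measurableSet_closedBall
      fun x hx => ?_
    have := hlow x hx
    gcongr
  have hgauss : ∀ s : E, Integrable (fun t : E => Real.exp (-b * ‖s + -t‖ ^ 2)) := by
    intro s
    have h := GaussianFourier.integrable_cexp_neg_mul_sq_norm_add (b := (b : ℂ)) (by simpa) 0 (0 : E)
    have h' : Integrable (fun t : E => Real.exp (-b * ‖t‖ ^ 2)) := by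
      refine h.norm.congr (ae_of_all _ fun t => ?_)
      simp [Complex.norm_exp, ← Complex.ofReal_pow]
    have := h'.comp_sub_left s
    simpa [sub_eq_add_neg] using this
  have hupper : ‖∫ t, charFun ν t ∂W‖
      ≤ volume.real B * (Real.pi / b) ^ (Module.finrank ℝ E / 2 : ℝ) := by
    have hmν := measurable_charFun (μ := ν)
    have hiW : Integrable (charFun ν) W :=
      Integrable.of_bound (C := 1) hmν.aestronglyMeasurable
        (ae_of_all _ fun x => norm_charFun_le_one x)
    have e : ∫ t, charFun ν t ∂W = ∫ s, ∫ t, charFun ν (s + -t) ∂V ∂V := by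
      rw [hW, integral_conv hiW]
      refine integral_congr_ae (ae_of_all _ fun s => ?_)
      dsimp only
      rw [integral_map (by fun_prop)]
      exact (hmν.comp (by fun_prop)).aestronglyMeasurable
    rw [e]
    have hb2 : ∀ᵐ s ∂V, ‖∫ t, charFun ν (s + -t) ∂V‖
        ≤ (Real.pi / b) ^ (Module.finrank ℝ E / 2 : ℝ) := by
      refine (ae_restrict_iff' measurableSet_ball).2 (ae_of_all _ fun s hs => ?_)
      rw [mem_ball_zero_iff] at hs
      have h1 : ‖∫ t, charFun ν (s + -t) ∂V‖ ≤ ∫ t, Real.exp (-b * ‖s + -t‖ ^ 2) ∂V := by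
        refine norm_integral_le_of_norm_le (hgauss s).integrableOn ?_
        refine (ae_restrict_iff' measurableSet_ball).2 (ae_of_all _ fun t ht => ?_)
        rw [mem_ball_zero_iff] at ht
        refine hν _ ((norm_add_le _ _).trans ?_)
        rw [norm_neg]; linarith
      refine h1.trans ((setIntegral_le_integral (hgauss s)
        (ae_of_all _ fun t => (Real.exp_pos _).le)).trans ?_)
      have := integral_sub_left_eq_self (fun t : E => Real.exp (-b * ‖t‖ ^ 2)) volume s
      simp_rw [← sub_eq_add_neg]
      rw [this, GaussianFourier.integral_rexp_neg_mul_sq_norm hb]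
    have := norm_integral_le_of_norm_le_const hb2
    refine this.trans (le_of_eq ?_)
    rw [mul_comm]; simp [hV]
  refine hlower.trans (le_trans ?_ hupper)
  rw [← integral_charFun_comm]
  simp_rw [hcf]
  rw [integral_complex_ofReal, Complex.norm_real]
  exact le_abs_self _

end CharFun

/-! ### Nondegeneracy of the covariance form. -/

section Covariance

variable {d : ℕ}

/-- The second moments of a full-dimensional law are bounded below in all directions. -/
lemma exists_mul_norm_sq_le_integral_inner_sq (μ : Measure (EuclideanSpace ℝ (Fin d)))
    (h2 : MemLp (fun x => x) 2 μ) (hdim : IsFullDimensional μ) :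
    ∃ q > 0, ∀ t : EuclideanSpace ℝ (Fin d), q * ‖t‖ ^ 2 ≤ ∫ x, ⟪x, t⟫ ^ 2 ∂μ := by
  have hco : ∀ a, MemLp (fun x : EuclideanSpace ℝ (Fin d) => x a) 2 μ := fun a =>
    h2.mono (by fun_prop) (ae_of_all _ fun x => PiLp.norm_apply_le x a)
  have hprod : ∀ a b, Integrable (fun x : EuclideanSpace ℝ (Fin d) => x a * x b) μ := fun a b =>
    (hco a).integrable_mul (hco b)
  have hmul : ∀ (t : EuclideanSpace ℝ (Fin d)) a,
      (covMatrix μ).mulVec t.ofLp a = ∫ x, x a * ⟪x, t⟫ ∂μ := by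
    intro t a
    have : ∀ x : EuclideanSpace ℝ (Fin d), x a * ⟪x, t⟫ = ∑ b, x a * x b * t b := by
      intro x
      rw [PiLp.inner_apply, Finset.mul_sum]
      refine Finset.sum_congr rfl fun b _ => ?_
      simp only [RCLike.inner_apply, conj_trivial]
      ring
    simp_rw [this]
    rw [integral_finsetSum _ fun b _ => (hprod a b).mul_const _]
    simp [Matrix.mulVec, dotProduct, covMatrix, integral_mul_const]
  have hIa : ∀ (t : EuclideanSpace ℝ (Fin d)) a,
      Integrable (fun x : EuclideanSpace ℝ (Fin d) => x a * ⟪x, t⟫) μ := fun t a =>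
    (hco a).integrable_mul (h2.inner_const t)
  have hquad : ∀ t : EuclideanSpace ℝ (Fin d),
      ∫ x, ⟪x, t⟫ ^ 2 ∂μ = ∑ a, t a * (covMatrix μ).mulVec t.ofLp a := by
    intro t
    simp_rw [hmul, ← integral_const_mul]
    rw [← integral_finsetSum _ fun a _ => (hIa t a).const_mul _]
    refine integral_congr_ae (ae_of_all _ fun x => ?_)
    dsimp only
    simp_rw [← mul_assoc]
    rw [← Finset.sum_mul, sq]
    simp [PiLp.inner_apply]
  have hpos : ∀ t : EuclideanSpace ℝ (Fin d), t ≠ 0 → 0 < ∫ x, ⟪x, t⟫ ^ 2 ∂μ := by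
    intro t ht
    refine lt_of_le_of_ne (integral_nonneg fun x => by positivity) fun h => ht ?_
    have hz : (fun x : EuclideanSpace ℝ (Fin d) => ⟪x, t⟫ ^ 2) =ᵐ[μ] 0 :=
      (integral_eq_zero_iff_of_nonneg (fun x => by positivity)
        (h2.inner_const t).integrable_sq).1 h.symm
    -- If the form vanishes at `t`, then `⟪x, t⟫ = 0` almost surely, so `t` is in the kernel of the
    -- covariance matrix.
    have hv : (covMatrix μ).mulVec t.ofLp = 0 := by
      funext a
      rw [hmul, Pi.zero_apply]
      refine integral_eq_zero_of_ae (hz.mono fun x hx => ?_)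
      have : ⟪x, t⟫ = 0 := by simpa using hx
      simp [this]
    have h0 := (Matrix.mulVec_injective_iff_isUnit.2 hdim) (hv.trans (Matrix.mulVec_zero _).symm)
    ext a
    simpa using congrFun h0 a
  have hcont : Continuous fun t : EuclideanSpace ℝ (Fin d) => ∫ x, ⟪x, t⟫ ^ 2 ∂μ := by
    simp_rw [hquad, Matrix.mulVec, dotProduct]
    fun_prop
  rcases (Metric.sphere (0 : EuclideanSpace ℝ (Fin d)) 1).eq_empty_or_nonempty with he | hne
  · refine ⟨1, one_pos, fun t => ?_⟩
    have ht : t = 0 := by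
      by_contra ht
      have : ‖t‖⁻¹ • t ∈ Metric.sphere (0 : EuclideanSpace ℝ (Fin d)) 1 := by
        simp [norm_smul, ht]
      simp [he] at this
    simp [ht]
  · obtain ⟨s, hs, hmin⟩ := (isCompact_sphere _ _).exists_isMinOn hne hcont.continuousOn
    have hs0 : s ≠ 0 := by
      rintro rfl
      simp at hs
    refine ⟨_, hpos s hs0, fun t => ?_⟩
    rcases eq_or_ne t 0 with rfl | ht
    · simp
    · have hmem : ‖t‖⁻¹ • t ∈ Metric.sphere (0 : EuclideanSpace ℝ (Fin d)) 1 := by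
        simp [norm_smul, ht]
      have h := hmin hmem
      simp only [Set.mem_ofPred_eq, inner_smul_right, mul_pow, integral_const_mul] at h
      have ht' : 0 < ‖t‖ := norm_pos_iff.2 ht
      calc _ ≤ (‖t‖⁻¹ ^ 2 * ∫ x, ⟪x, t⟫ ^ 2 ∂μ) * ‖t‖ ^ 2 := by gcongr
        _ = _ := by field_simp

end Covariance


/-! ### Sums of independent steps with prescribed counts. -/

section StepSums

variable {E : Type*} [NormedAddCommGroup E] [InnerProductSpace ℝ E] [FiniteDimensional ℝ E]
  [MeasurableSpace E] [BorelSpace E]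

/-- The law of a sum of independent vectors, `p j` of which have law `μ j`, for each `j`. -/
lemma exists_charFun_eq_prod_pow {ι : Type*} [Fintype ι] (μ : ι → Measure E)
    [∀ j, IsProbabilityMeasure (μ j)] (p : ι → ℕ) :
    ∃ ν : Measure E, IsProbabilityMeasure ν ∧ ∀ t, charFun ν t = ∏ j, charFun (μ j) t ^ p j := by
  classical
  have hpow : ∀ j (n : ℕ), ∃ ν : Measure E, IsProbabilityMeasure ν ∧
      ∀ t, charFun ν t = charFun (μ j) t ^ n := by
    intro j n
    induction n with
    | zero => exact ⟨Measure.dirac 0, inferInstance, fun t => by simp⟩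
    | succ n ih =>
      obtain ⟨ν, hν, h⟩ := ih
      exact ⟨ν ∗ μ j, inferInstance, fun t => by rw [charFun_conv, h, pow_succ]⟩
  suffices ∀ s : Finset ι, ∃ ν : Measure E, IsProbabilityMeasure ν ∧
      ∀ t, charFun ν t = ∏ j ∈ s, charFun (μ j) t ^ p j from this _
  intro s
  induction s using Finset.induction_on with
  | empty => exact ⟨Measure.dirac 0, inferInstance, fun t => by simp⟩
  | insert j s hj ih =>
    obtain ⟨ν, hν, h⟩ := ih
    obtain ⟨ν', hν', h'⟩ := hpow j (p j)
    exact ⟨ν' ∗ ν, inferInstance, fun t => by rw [charFun_conv, h, h', Finset.prod_insert hj]⟩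

/-- Small ball estimate for sums of independent steps, uniform in the number of steps of
each kind. -/
lemma exists_measureReal_closedBall_le {ι : Type*} [Fintype ι] [Nonempty ι] (μ : ι → Measure E)
    (hμ : ∀ j, ∃ c > 0, ∃ δ > 0, ∀ t, ‖t‖ ≤ δ → ‖charFun (μ j) t‖ ≤ Real.exp (-c * ‖t‖ ^ 2))
    {r : ℝ} (hr : 0 < r) :
    ∃ C, 0 ≤ C ∧ ∀ (p : ι → ℕ) (ν : Measure E), IsProbabilityMeasure ν →
      (∀ t, charFun ν t = ∏ j, charFun (μ j) t ^ p j) → 0 < ∑ j, p j →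
      ν.real (Metric.closedBall 0 r)
        ≤ C * ((∑ j, p j : ℕ) : ℝ) ^ (-(Module.finrank ℝ E / 2 : ℝ)) := by
  choose c hc δ hδ h using hμ
  obtain ⟨j₁, hj₁⟩ := Finite.exists_min c
  obtain ⟨j₂, hj₂⟩ := Finite.exists_min δ
  -- Both constraints of the small ball estimate: `2 * ρ ≤ δ j` for all `j`, and `r * ρ ≤ 1`.
  set ρ := min (δ j₂ / 2) r⁻¹ with hρ
  have hρ0 : 0 < ρ := lt_min (half_pos (hδ _)) (inv_pos.2 hr)
  set v := volume.real (Metric.ball (0 : E) ρ) with hv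
  have hv0 : 0 < v := by
    rw [hv, measureReal_def]
    exact ENNReal.toReal_pos (Metric.measure_ball_pos _ _ hρ0).ne' measure_ball_lt_top.ne
  refine ⟨4 / v * (Real.pi / c j₁) ^ (Module.finrank ℝ E / 2 : ℝ), ?_, fun p ν hν hνp hp => ?_⟩
  · have := hc j₁
    positivity
  set n := ∑ j, p j with hn
  have hn0 : (0 : ℝ) < n := by exact_mod_cast hp
  have hb : 0 < c j₁ * n := mul_pos (hc _) hn0
  have key := measureReal_closedBall_mul_le ν (r := r) (ρ := ρ) hb ?_ ?_
  · rw [← div_div, div_eq_mul_inv _ (n : ℝ),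
      Real.mul_rpow (div_nonneg Real.pi_pos.le (hc _).le) (by positivity), Real.inv_rpow hn0.le,
      ← Real.rpow_neg hn0.le] at key
    rw [← hv] at key
    have : ν.real (Metric.closedBall 0 r) = 4 / v ^ 2 *
        (ν.real (Metric.closedBall 0 r) * (v / 2) ^ 2) := by field_simp; norm_num
    rw [this]
    calc _ ≤ 4 / v ^ 2 * (v * ((Real.pi / c j₁) ^ (Module.finrank ℝ E / 2 : ℝ) *
          (n : ℝ) ^ (-(Module.finrank ℝ E / 2 : ℝ)))) := by gcongr
      _ = _ := by field_simp
  · calc r * ρ ≤ r * r⁻¹ := by gcongr; exact min_le_right _ _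
      _ = 1 := mul_inv_cancel₀ hr.ne'
  · intro t ht
    have ht' : ∀ j, ‖t‖ ≤ δ j := fun j => by
      have := min_le_left (δ j₂ / 2) r⁻¹
      have := hj₂ j
      linarith
    rw [hνp, norm_prod]
    calc ∏ j, ‖charFun (μ j) t ^ p j‖ ≤ ∏ j, Real.exp (-c j₁ * ‖t‖ ^ 2) ^ p j := by
          refine Finset.prod_le_prod (fun _ _ => norm_nonneg _) fun j _ => ?_
          rw [norm_pow]
          refine pow_le_pow_left₀ (norm_nonneg _) ((h j t (ht' j)).trans ?_) _
          have := hj₁ j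
          gcongr
      _ = Real.exp (-(c j₁ * n) * ‖t‖ ^ 2) := by
          rw [Finset.prod_pow_eq_pow_sum, ← Real.exp_nat_mul, ← hn]
          congr 1
          ring

end StepSums

/-- The number of times each of the rules has been used before time `i`. -/
def useCount {Ω : Type*} {k : ℕ} (ℓ : ℕ → Ω → Fin k) : ℕ → Ω → Fin k → ℕ
  | 0, _ => 0
  | i + 1, ω => useCount ℓ i ω + Pi.single (ℓ i ω) 1

lemma sum_useCount {Ω : Type*} {k : ℕ} (ℓ : ℕ → Ω → Fin k) (i : ℕ) (ω : Ω) :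
    ∑ j, useCount ℓ i ω j = i := by
  induction i with
  | zero => simp [useCount]
  | succ i ih => simp [useCount, Finset.sum_add_distrib, ih]

/-- The fixed sum determines the coordinate `0` from the `k` others. Saving this one power of `n` is
what makes `d ≥ 2 * k + 1` enough in the theorem. -/
lemma card_piAntidiag_le (k n : ℕ) :
    (Finset.piAntidiag (Finset.univ : Finset (Fin (k + 1))) n).card ≤ (n + 1) ^ k := by
  classical
  have hcard : (Fintype.piFinset fun _ : Fin k => Finset.range (n + 1)).card = (n + 1) ^ k := by
    simp
  rw [← hcard]
  refine Finset.card_le_card_of_injOn (fun m j => m j.succ) ?_ ?_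
  · intro m hm
    simp only [Finset.mem_coe, Fintype.mem_piFinset, Finset.mem_range,
      Finset.mem_piAntidiag] at hm ⊢
    intro j
    have := Finset.single_le_sum (f := m) (fun _ _ => Nat.zero_le _) (Finset.mem_univ j.succ)
    exact Nat.lt_succ_of_le (this.trans_eq hm.1)
  · intro m hm m' hm' h
    simp only [Finset.mem_coe, Finset.mem_piAntidiag] at hm hm'
    have hs : ∀ j : Fin k, m j.succ = m' j.succ := fun j => congrFun h j
    have h1 := hm.1
    have h2 := hm'.1
    rw [Fin.sum_univ_succ] at h1 h2
    simp_rw [hs] at h1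
    funext j
    refine Fin.cases ?_ hs j
    omega

/-- Borel–Cantelli for each integer radius, since `3 / 2 > 1`. -/
lemma isTransient_of_measure_norm_le_le {Ω : Type*} [MeasurableSpace Ω] {P : Measure Ω} {d : ℕ}
    {X : ℕ → Ω → EuclideanSpace ℝ (Fin d)}
    (h : ∀ r : ℝ, 0 < r → ∃ C, 0 ≤ C ∧ ∀ n : ℕ, 0 < n →
      P {ω | ‖X n ω‖ ≤ r} ≤ ENNReal.ofReal (C * (n : ℝ) ^ (-(3 / 2) : ℝ))) :
    IsTransient P X := by
  have hr : ∀ r : ℕ, ∀ᵐ ω ∂P, ∀ᶠ n in atTop, ω ∉ {ω | ‖X (n + 1) ω‖ ≤ (r : ℝ) + 1} := by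
    intro r
    obtain ⟨C, hC, hCn⟩ := h (r + 1) (by positivity)
    refine ae_eventually_notMem (ne_top_of_le_ne_top ?_
      (ENNReal.tsum_le_tsum fun n => hCn (n + 1) n.succ_pos))
    have hs : Summable fun n : ℕ => C * (n : ℝ) ^ (-(3 / 2) : ℝ) :=
      (Real.summable_nat_rpow.2 (by norm_num)).mul_left C
    exact ((summable_nat_add_iff 1).2 hs).tsum_ofReal_ne_top
  filter_upwards [ae_all_iff.2 hr] with ω hω
  refine (tendsto_add_atTop_iff_nat 1).1 (tendsto_atTop.2 fun b => ?_)
  obtain ⟨r, hbr⟩ := exists_nat_ge b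
  filter_upwards [hω r] with n hn
  simp only [not_le] at hn
  linarith

/-! ### Comparison of the adapted walk with deterministic orders. -/

section Walk

variable {Ω : Type*} [mΩ : MeasurableSpace Ω] {P : Measure Ω} [IsProbabilityMeasure P] {d k : ℕ}
  {μ : Fin k → Measure (EuclideanSpace ℝ (Fin d))} {F : Filtration ℕ mΩ}
  {ξ : Fin k → ℕ → Ω → EuclideanSpace ℝ (Fin d)} {ℓ : ℕ → Ω → Fin k}
  {X : ℕ → Ω → EuclideanSpace ℝ (Fin d)}

lemma measurable_useCount (hℓ : ∀ i, Measurable[F i] (ℓ i)) (i : ℕ) :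
    Measurable[F i] (useCount ℓ i) := by
  induction i with
  | zero => exact measurable_const
  | succ i ih =>
    have h1 : Measurable[F (i + 1)] (useCount ℓ i) := ih.mono (F.mono i.le_succ) le_rfl
    have h2 : Measurable[F (i + 1)] (ℓ i) := (hℓ i).mono (F.mono i.le_succ) le_rfl
    exact h1.add ((measurable_from_top (f := fun j : Fin k => (Pi.single j 1 : Fin k → ℕ))).comp h2)

/-- On the event `ℓ i = j`, the next step has law `μ j` and is independent of the rule, counts and
position at time `i`. Splitting over `j` thus needs only the law of one candidate step at a time. -/
lemma IsGenerated.lintegral_succ_le (hX : IsGenerated P μ F ξ ℓ X)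
    {u : (Fin k → ℕ) → EuclideanSpace ℝ (Fin d) → ENNReal} (hu : ∀ s, Measurable (u s))
    (hsuper : ∀ s x j, ∫⁻ z, u (s + Pi.single j 1) (x + z) ∂(μ j) ≤ u s x) (i : ℕ) :
    ∫⁻ ω, u (useCount ℓ (i + 1) ω) (X (i + 1) ω) ∂P ≤ ∫⁻ ω, u (useCount ℓ i ω) (X i ω) ∂P := by
  have hle := F.le i
  have hℓ : Measurable (ℓ i) := (hX.rule_adapted i).mono hle le_rfl
  have hsets : ∀ j, MeasurableSet (ℓ i ⁻¹' {j}) := fun j => hℓ (measurableSet_singleton j)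
  have hsplit : ∀ f : Ω → ENNReal, ∫⁻ ω, f ω ∂P = ∑ j, ∫⁻ ω in ℓ i ⁻¹' {j}, f ω ∂P := by
    intro f
    have hU : ⋃ j, ℓ i ⁻¹' {j} = Set.univ := by
      rw [← Set.preimage_iUnion, Set.iUnion_of_singleton, Set.preimage_univ]
    rw [← setLIntegral_univ, ← hU, lintegral_iUnion hsets
      (fun a b hab => Disjoint.preimage _ (by simpa using hab)), tsum_fintype]
  have humeas : Measurable (Function.uncurry u) := measurable_from_prod_countable_right hu
  rw [hsplit, hsplit]
  refine Finset.sum_le_sum fun j _ => ?_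
  let Y : Ω → Fin k × (Fin k → ℕ) × EuclideanSpace ℝ (Fin d) :=
    fun ω => (ℓ i ω, useCount ℓ i ω, X i ω)
  have hYF : Measurable[F i] Y := (hX.rule_adapted i).prodMk
    ((measurable_useCount hX.rule_adapted i).prodMk (hX.walk_adapted i))
  have hY : Measurable Y := hYF.mono hle le_rfl
  have hξ := hX.step_measurable j i
  have hind : IndepFun Y (ξ j (i + 1)) P := by
    rw [IndepFun_iff_Indep]
    exact (indep_of_indep_of_le_right (hX.step_indep_past j i) hYF.comap_le).symm
  have hmap := (indepFun_iff_map_prod_eq_prod_map_map hY.aemeasurable hξ.aemeasurable).1 hind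
  rw [hX.step_law] at hmap
  have : IsProbabilityMeasure (μ j) := by
    rw [← hX.step_law j i]; exact Measure.isProbabilityMeasure_map hξ.aemeasurable
  let g : (Fin k × (Fin k → ℕ) × EuclideanSpace ℝ (Fin d)) × EuclideanSpace ℝ (Fin d) → ENNReal :=
    fun y => if y.1.1 = j then u (y.1.2.1 + Pi.single j 1) (y.1.2.2 + y.2) else 0
  have hg : Measurable g := by
    refine Measurable.ite ?_ ?_ measurable_const
    · exact (measurable_fst.comp measurable_fst) (measurableSet_singleton j)
    · exact humeas.comp (by fun_prop : Measurable fun y :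
        (Fin k × (Fin k → ℕ) × EuclideanSpace ℝ (Fin d)) × EuclideanSpace ℝ (Fin d) =>
          (y.1.2.1 + Pi.single j 1, y.1.2.2 + y.2))
  have e1 : ∫⁻ ω in ℓ i ⁻¹' {j}, u (useCount ℓ (i + 1) ω) (X (i + 1) ω) ∂P
      = ∫⁻ ω, g (Y ω, ξ j (i + 1) ω) ∂P := by
    rw [← lintegral_indicator (hsets j)]
    refine lintegral_congr fun ω => ?_
    by_cases h : ℓ i ω = j
    · simp [g, Y, h, useCount, hX.walk_succ]
    · simp [g, Y, h]
  rw [e1, ← lintegral_map hg (hY.prodMk hξ), hmap, lintegral_prod _ hg.aemeasurable,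
    lintegral_map hg.lintegral_prod_right' hY, ← lintegral_indicator (hsets j)]
  refine lintegral_mono fun ω => ?_
  by_cases h : ℓ i ω = j
  · simpa [g, Y, h] using hsuper _ _ _
  · simp [g, Y, h]

lemma IsGenerated.lintegral_le (hX : IsGenerated P μ F ξ ℓ X)
    {u : (Fin k → ℕ) → EuclideanSpace ℝ (Fin d) → ENNReal} (hu : ∀ s, Measurable (u s))
    (hsuper : ∀ s x j, ∫⁻ z, u (s + Pi.single j 1) (x + z) ∂(μ j) ≤ u s x) (i : ℕ) :
    ∫⁻ ω, u (useCount ℓ i ω) (X i ω) ∂P ≤ u 0 0 := by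
  induction i with
  | zero => simp [useCount, hX.walk_zero]
  | succ i ih => exact (hX.lintegral_succ_le hu hsuper i).trans ih

/-- An adapted rule which uses each `μ j` exactly `m j` times does not hit a ball with a larger
probability than the rule that uses them in a deterministic order. -/
lemma IsGenerated.measure_useCount_eq_le (hX : IsGenerated P μ F ξ ℓ X)
    [∀ j, IsProbabilityMeasure (μ j)] {m : Fin k → ℕ}
    {ν : Measure (EuclideanSpace ℝ (Fin d))} [IsProbabilityMeasure ν]
    (hν : ∀ t, charFun ν t = ∏ j, charFun (μ j) t ^ m j) (r : ℝ) (n : ℕ) :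
    P {ω | useCount ℓ n ω = m ∧ ‖X n ω‖ ≤ r} ≤ ν (Metric.closedBall 0 r) := by
  classical
  choose N hN hNc using exists_charFun_eq_prod_pow μ
  set B : Set (EuclideanSpace ℝ (Fin d)) := Metric.closedBall 0 r
  have hB : MeasurableSet B := measurableSet_closedBall
  -- The probability of ending in the ball from `x` when the budget `m - s` remains; it is `0` once
  -- the budget is overspent.
  let u : (Fin k → ℕ) → EuclideanSpace ℝ (Fin d) → ENNReal := fun s x =>
    if s ≤ m then ∫⁻ y, B.indicator 1 (x + y) ∂(N (m - s)) else 0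
  have hBm : Measurable (B.indicator (1 : EuclideanSpace ℝ (Fin d) → ENNReal)) :=
    measurable_one.indicator hB
  have hu : ∀ s, Measurable (u s) := by
    intro s
    by_cases h : s ≤ m
    · simp only [u, h, if_true]
      exact (hBm.comp measurable_add).lintegral_prod_right'
    · simp only [u, h, if_false]
      exact measurable_const
  have hsuper : ∀ s x j, ∫⁻ z, u (s + Pi.single j 1) (x + z) ∂(μ j) ≤ u s x := by
    intro s x j
    by_cases h : s + Pi.single j 1 ≤ m
    · have hs : s ≤ m := le_self_add.trans h
      simp only [u, h, hs, if_true]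
      -- Any law with budget left may be taken as the next step, so within the budget the inequality
      -- is an equality.
      have hconv : N (m - s) = μ j ∗ N (m - (s + Pi.single j 1)) := by
        refine Measure.ext_of_charFun (funext fun t => ?_)
        rw [charFun_conv, hNc, hNc]
        have hms : m - s = Pi.single j 1 + (m - (s + Pi.single j 1)) := by
          rw [← tsub_tsub, add_tsub_cancel_of_le (le_tsub_of_add_le_left h)]
        rw [hms]
        simp_rw [Pi.add_apply, pow_add, Finset.prod_mul_distrib]
        congr 1
        · rw [Finset.prod_eq_single j]
          · simp
          · intro b _ hb
            simp [hb]
          · simp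
      rw [hconv, Measure.lintegral_conv (f := fun y => B.indicator 1 (x + y))
        (hBm.comp (measurable_const_add x))]
      simp_rw [add_assoc]
      exact le_rfl
    · simp [u, h]
  have hfin := hX.lintegral_le hu hsuper n
  have hN0 : N 0 = Measure.dirac 0 := by
    refine Measure.ext_of_charFun (funext fun t => ?_)
    rw [hNc]; simp
  have hNm : N m = ν := Measure.ext_of_charFun (funext fun t => by rw [hNc, hν])
  have hu0 : u 0 0 = ν B := by
    simp [u, hNm, lintegral_indicator_one hB]
  rw [← hu0]
  refine le_trans ?_ hfin
  have hXn : Measurable (X n) := (hX.walk_adapted n).mono (F.le n) le_rfl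
  have hCn : Measurable (useCount ℓ n) :=
    (measurable_useCount hX.rule_adapted n).mono (F.le n) le_rfl
  have hA : MeasurableSet {ω | useCount ℓ n ω = m ∧ ‖X n ω‖ ≤ r} :=
    (hCn (measurableSet_singleton m)).inter (measurableSet_le hXn.norm measurable_const)
  rw [← lintegral_indicator_one hA]
  refine lintegral_mono fun ω => ?_
  by_cases hω : useCount ℓ n ω = m ∧ ‖X n ω‖ ≤ r
  · simp [u, hω.1, hN0, B, hω.2]
  · simp [hω]

/-- The walk returns to a ball at time `n` with probability at most `C / n ^ (3 / 2)`. -/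
lemma IsGenerated.exists_measure_norm_le_le [NeZero k] (hX : IsGenerated P μ F ξ ℓ X)
    [∀ j, IsProbabilityMeasure (μ j)] (hd : 2 * k + 1 ≤ d)
    (hμ : ∀ j, ∃ c > 0, ∃ δ > 0, ∀ t, ‖t‖ ≤ δ → ‖charFun (μ j) t‖ ≤ Real.exp (-c * ‖t‖ ^ 2))
    {r : ℝ} (hr : 0 < r) :
    ∃ C, 0 ≤ C ∧ ∀ n : ℕ, 0 < n →
      P {ω | ‖X n ω‖ ≤ r} ≤ ENNReal.ofReal (C * (n : ℝ) ^ (-(3 / 2) : ℝ)) := by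
  obtain ⟨k, rfl⟩ : ∃ k', k = k' + 1 := Nat.exists_eq_succ_of_ne_zero (NeZero.ne k)
  obtain ⟨C, hC, hball⟩ := exists_measureReal_closedBall_le μ hμ hr
  refine ⟨2 ^ k * C, by positivity, fun n hn => ?_⟩
  have hn1 : (1 : ℝ) ≤ n := by exact_mod_cast hn
  have hn0 : (0 : ℝ) < n := by linarith
  have hsub : {ω | ‖X n ω‖ ≤ r} ⊆ ⋃ m ∈ Finset.piAntidiag (Finset.univ : Finset (Fin (k + 1))) n,
      {ω | useCount ℓ n ω = m ∧ ‖X n ω‖ ≤ r} := by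
    intro ω hω
    simp only [Set.mem_iUnion]
    exact ⟨useCount ℓ n ω, by simp [sum_useCount], rfl, hω⟩
  refine (measure_mono hsub).trans ((measure_biUnion_finset_le _ _).trans ?_)
  have hone : ∀ m ∈ Finset.piAntidiag (Finset.univ : Finset (Fin (k + 1))) n,
      P {ω | useCount ℓ n ω = m ∧ ‖X n ω‖ ≤ r} ≤ ENNReal.ofReal (C * (n : ℝ) ^ (-(d / 2 : ℝ))) := by
    intro m hm
    have hsum : ∑ j, m j = n := (Finset.mem_piAntidiag.1 hm).1
    obtain ⟨ν, hν, hνc⟩ := exists_charFun_eq_prod_pow μ m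
    refine (hX.measure_useCount_eq_le hνc r n).trans ?_
    rw [← ofReal_measureReal]
    refine ENNReal.ofReal_le_ofReal ?_
    have := hball m ν hν hνc (by omega)
    rwa [hsum, finrank_euclideanSpace_fin] at this
  refine (Finset.sum_le_card_nsmul _ _ _ hone).trans ?_
  rw [nsmul_eq_mul, ← ENNReal.ofReal_natCast, ← ENNReal.ofReal_mul (by positivity)]
  refine ENNReal.ofReal_le_ofReal ?_
  have hcard : ((Finset.piAntidiag (Finset.univ : Finset (Fin (k + 1))) n).card : ℝ)
      ≤ 2 ^ k * (n : ℝ) ^ k := by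
    rw [← mul_pow]
    calc _ ≤ (((n + 1) ^ k : ℕ) : ℝ) := by exact_mod_cast card_piAntidiag_le k n
      _ = ((n : ℝ) + 1) ^ k := by push_cast; rfl
      _ ≤ (2 * (n : ℝ)) ^ k := by gcongr; linarith
  calc _ ≤ (2 ^ k * (n : ℝ) ^ k) * (C * (n : ℝ) ^ (-(d / 2 : ℝ))) := by gcongr
    _ = 2 ^ k * C * (n : ℝ) ^ ((k : ℝ) + -(d / 2 : ℝ)) := by
      rw [Real.rpow_add hn0, Real.rpow_natCast]; ring
    _ ≤ _ := by
      -- The number of laws is now `k + 1`, so this gives `k - d / 2 ≤ -3 / 2`.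
      have hd' : (2 * (k + 1) + 1 : ℝ) ≤ d := by exact_mod_cast hd
      gcongr
      linarith

end Walk

end AdaptedWalk

theorem proposition1p3 {d k : ℕ} (hd : 2 * k + 1 ≤ d)
    (μ : Fin k → Measure (EuclideanSpace ℝ (Fin d)))
    (hprob : ∀ j, IsProbabilityMeasure (μ j))
    (hmean : ∀ j, AdaptedWalk.MeanZero (μ j))
    (β : ℝ) (hβ : 0 < β) (hmom : ∀ j, AdaptedWalk.HasMoments (μ j) (2 + β))
    (hdim : ∀ j, AdaptedWalk.IsFullDimensional (μ j))
    {Ω : Type*} [mΩ : MeasurableSpace Ω] (P : Measure Ω) [IsProbabilityMeasure P]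
    (F : Filtration ℕ mΩ)
    (ξ : Fin k → ℕ → Ω → EuclideanSpace ℝ (Fin d))
    (ℓ : ℕ → Ω → Fin k)
    (X : ℕ → Ω → EuclideanSpace ℝ (Fin d))
    (hX : AdaptedWalk.IsGenerated P μ F ξ ℓ X) :
    AdaptedWalk.IsTransient P X := by
  obtain ⟨ω⟩ : Nonempty Ω := nonempty_of_isProbabilityMeasure P
  -- The value `ℓ 0 ω` inhabits `Fin k`, so `k ≥ 1`.
  have : NeZero k := ⟨fun h => (Fin.cast h (ℓ 0 ω)).elim0⟩
  refine AdaptedWalk.isTransient_of_measure_norm_le_le fun r hr =>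
    hX.exists_measure_norm_le_le hd (fun j => ?_) hr
  have h2β : MemLp (fun x => x) (ENNReal.ofReal (2 + β)) (μ j) := by
    refine ⟨by fun_prop, ?_⟩
    rw [eLpNorm_lt_top_iff_lintegral_rpow_enorm_lt_top (by simp; linarith) (by simp),
      ENNReal.toReal_ofReal (by linarith)]
    exact hmom j
  have h2 : MemLp (fun x => x) 2 (μ j) := by
    refine h2β.mono_exponent ?_
    rw [← ENNReal.ofReal_ofNat]
    exact ENNReal.ofReal_le_ofReal (by linarith)
  obtain ⟨q, hq, hQ⟩ := AdaptedWalk.exists_mul_norm_sq_le_integral_inner_sq (μ j) h2 (hdim j)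
  exact AdaptedWalk.exists_norm_charFun_le_exp (μ j) h2 (hmean j).2 hq hQ
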